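/- **Definitions.** Let $H$ be a complex Hilbert space and $E$ a finite-dimensional complex Hilbert space. A *two-operator commutative vessel* is a collection $V=(A_1,A_2,H,\Phi,E,\sigma_1,\sigma_2,\gamma^{in},\gamma^{out})$ of bounded operators $A_1,A_2:H\to H$ with $A_1A_2=A_2A_1$, $\Phi:H\to E$, and selfadjoint $\sigma_1,\sigma_2,\gamma^{in},\gamma^{out}:E\to E$ such that $$\Phi^*\sigma_k\Phi=\tfrac1i(A_k-A_k^*)\ (k=1,2),\qquad \gamma^{in}\Phi=\sigma_1\Phi A_2^*-\sigma_2\Phi A_1^*,\qquad \gamma^{out}\Phi=\sigma_1\Phi A_2-\sigma_2\Phi A_1,$$ $$\gamma^{out}=\gamma^{in}+i(\sigma_1\Phi\Phi^*\sigma_2-\sigma_2\Phi\Phi^*\sigma_1).$$ Let $V$ be such a vessel, and let $p_0,p_1,p_2\in\mathbb R[y_1,y_2]$ be such that $p_0(A_1,A_2)$ is invertible, so that $r_k(A_1,A_2)=p_k(A_1,A_2)\,p_0(A_1,A_2)^{-1}$ is defined for the rational map $r=(r_1,r_2)=(p_1/p_0,p_2/p_0)$. Let $n$ be the maximum of the degrees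 of $p_0,p_1,p_2$, and let $P_k(x_0,x_1,x_2)=x_0^n\,p_k(x_1/x_0,x_2/x_0)$ be the homogenization of $p_k$ up to degree $n$. *Bezout matrices.* The index set is $I_n=\{i=(i_0,i_1,i_2)\in\mathbb Z_{\ge0}^3: i_0+i_1+i_2=n-1\}$, an element of which is determined by $(i_1,i_2)$; write $x^i=x_0^{i_0}x_1^{i_1}x_2^{i_2}$. A *Bezout triple* of a pair $(P,Q)$ of forms of degree $n$ consists of real symmetric matrices $\beta^{10},\beta^{20},\beta^{12}$ indexed by $I_n$ such that $$P(x)Q(y)-Q(x)P(y)=\sum_{i,j\in I_n}x^i\bigl[\beta^{10}_{ij}(x_1y_0-x_0y_1)+\beta^{20}_{ij}(x_2y_0-x_0y_2)+\beta^{12}_{ij}(x_1y_2-x_2y_1)\bigr]y^j .$$ Let $W_n=\bigoplus_{i\in I_n}E$ (orthogonal sum), with vectors $w=(w_{i_1,i_2})_{i_1+i_2\le n-1}$, and let the principal subspace be $$V_n=\{w\in W_n:\ \sigma_2w_{i_1+1,i_2}-\sigma_1w_{i_1,i_2+1}+\gamma^{in}w_{i_1,i_2}=0\ \text{ whenever }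 i_1+i_2\le n-2\}.$$ Given a Bezout triple of $(P,Q)$, let $B(P,Q)=\beta^{12}\otimes\gamma^{in}+\beta^{10}\otimes\sigma_1+\beta^{20}\otimes\sigma_2$ on $W_n$, and let $B'(P,Q)$ be its compression to $V_n$, that is $B(P,Q)$ restricted to $V_n$ followed by the orthogonal projection $P_{V_n}$ of $W_n$ onto $V_n$. **Theorem 3.1.** Each of the pairs $(P_1,P_0)$, $(P_2,P_0)$, $(P_1,P_2)$ has a Bezout triple. Whichever triples are chosen, put $$A'_k=r_k(A_1,A_2)\ (k=1,2),\qquad E'=V_n,\qquad \Phi'=P_{V_n}\bigl(\Phi A_1^{*i_1}A_2^{*i_2}\,p_0(A_1^*,A_2^*)^{-1}\bigr)_{i_1+i_2\le n-1}:H\to E',$$ $$\sigma'_1=B'(P_1,P_0),\qquad \sigma'_2=B'(P_2,P_0),\qquad \gamma'^{in}=B'(P_1,P_2),$$ $$\gamma'^{out}=\gamma'^{in}+i(\sigma'_1\Phi'\Phi'^*\sigma'_2-\sigma'_2\Phi'\Phi'^*\sigma'_1).$$ Then $V'=(A'_1,A'_2,H,\Phi',E',\sigma'_1,\sigma'_2,\gamma'^{in},\gamma'^{out})$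 is a commutative vessel. In particular, this solves the problem of finding $\Phi',E',\sigma'_k,\gamma'^{in},\gamma'^{out}$ that complete the operators $r_1(A_1,A_2)$, $r_2(A_1,A_2)$ on $H$ to a vessel. -/

import Mathlib

open scoped BigOperators

noncomputable section

namespace Vessel

open MvPolynomial

/-- The collection `(A₁, A₂, H, Φ, E, σ₁, σ₂, γⁱⁿ, γᵒᵘᵗ)` of operators underlying a two-operator
vessel, without the conditions that make it a vessel. -/
structure Data (H E : Type*) [NormedAddCommGroup H] [InnerProductSpace ℂ H]
    [NormedAddCommGroup E] [InnerProductSpace ℂ E] where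
  A₁ : H →L[ℂ] H
  A₂ : H →L[ℂ] H
  Φ : H →L[ℂ] E
  σ₁ : E →L[ℂ] E
  σ₂ : E →L[ℂ] E
  γin : E →L[ℂ] E
  γout : E →L[ℂ] E

/-- The collection is a commutative vessel. For two operators the antisymmetric families
`γⁱⁿ_{ij}`, `γᵒᵘᵗ_{ij}` are determined by `γⁱⁿ = γⁱⁿ₁₂`, `γᵒᵘᵗ = γᵒᵘᵗ₁₂`; the conditions for
`i = j` are void and those for `(i, j) = (2, 1)` are the negatives of those for `(1, 2)`. -/
structure Data.IsCommutativeVessel {H E : Type*}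
    [NormedAddCommGroup H] [InnerProductSpace ℂ H] [CompleteSpace H]
    [NormedAddCommGroup E] [InnerProductSpace ℂ E] [CompleteSpace E]
    (V : Data H E) : Prop where
  commute : V.A₁ ∘L V.A₂ = V.A₂ ∘L V.A₁
  σ₁_selfAdjoint : IsSelfAdjoint V.σ₁
  σ₂_selfAdjoint : IsSelfAdjoint V.σ₂
  γin_selfAdjoint : IsSelfAdjoint V.γin
  γout_selfAdjoint : IsSelfAdjoint V.γout
  colligation₁ : V.Φ.adjoint ∘L V.σ₁ ∘L V.Φ = (1 / Complex.I) • (V.A₁ - V.A₁.adjoint)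
  colligation₂ : V.Φ.adjoint ∘L V.σ₂ ∘L V.Φ = (1 / Complex.I) • (V.A₂ - V.A₂.adjoint)
  input : V.γin ∘L V.Φ =
    V.σ₁ ∘L V.Φ ∘L V.A₂.adjoint - V.σ₂ ∘L V.Φ ∘L V.A₁.adjoint
  output : V.γout ∘L V.Φ = V.σ₁ ∘L V.Φ ∘L V.A₂ - V.σ₂ ∘L V.Φ ∘L V.A₁
  linkage : V.γout = V.γin + Complex.I •
    (V.σ₁ ∘L V.Φ ∘L V.Φ.adjoint ∘L V.σ₂ - V.σ₂ ∘L V.Φ ∘L V.Φ.adjoint ∘L V.σ₁)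

/-- The value `p(S, T)` of a real polynomial in two variables at a pair of (commuting)
operators. -/
def evalOp {H : Type*} [NormedAddCommGroup H] [InnerProductSpace ℂ H]
    (p : MvPolynomial (Fin 2) ℝ) (S T : H →L[ℂ] H) : H →L[ℂ] H :=
  ∑ m ∈ p.support, ((p.coeff m : ℝ) : ℂ) • (S ^ m 0 * T ^ m 1)

/-- The maximal degree of `p₀`, `p₁`, `p₂`. -/
def maxDegree (p₀ p₁ p₂ : MvPolynomial (Fin 2) ℝ) : ℕ :=
  max p₀.totalDegree (max p₁.totalDegree p₂.totalDegree)

/-- The homogenization of `p(y₁, y₂)` up to degree `n` (at least the degree of `p`), that is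
`x₀ ^ n * p (x₁ / x₀, x₂ / x₀)`. -/
def homogenize (n : ℕ) (p : MvPolynomial (Fin 2) ℝ) : MvPolynomial (Fin 3) ℝ :=
  ∑ m ∈ p.support, C (p.coeff m) * (X 0 ^ (n - (m 0 + m 1)) * X 1 ^ m 0 * X 2 ^ m 1)

/-- Multi-indices `(i₀, i₁, i₂)` with `i₀ + i₁ + i₂ = n - 1`, recorded as the pair `(i₁, i₂)`;
there are `n (n + 1) / 2` of them. -/
abbrev Idx (n : ℕ) : Type :=
  {i : Fin n × Fin n // (i.1 : ℕ) + (i.2 : ℕ) < n}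

/-- The monomial `z₀ ^ i₀ * z₁ ^ i₁ * z₂ ^ i₂` of degree `n - 1` with multi-index `i`. -/
def monom {R : Type*} [CommRing R] {n : ℕ} (z : Fin 3 → R) (i : Idx n) : R :=
  z 0 ^ (n - 1 - ((i.1.1 : ℕ) + (i.1.2 : ℕ))) * z 1 ^ (i.1.1 : ℕ) * z 2 ^ (i.1.2 : ℕ)

/-- The first group `x₀, x₁, x₂` of variables. -/
def xvar (k : Fin 3) : MvPolynomial (Fin 3 ⊕ Fin 3) ℝ := X (Sum.inl k)

/-- The second group `y₀, y₁, y₂` of variables. -/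
def yvar (k : Fin 3) : MvPolynomial (Fin 3 ⊕ Fin 3) ℝ := X (Sum.inr k)

/-- Three symmetric real matrices `β¹⁰`, `β²⁰`, `β¹²` that represent `p(x) q(y) - q(x) p(y)`,
for `p`, `q` homogeneous of degree `n` in three variables. -/
structure BezoutTriple (n : ℕ) (p q : MvPolynomial (Fin 3) ℝ) where
  b10 : Matrix (Idx n) (Idx n) ℝ
  b20 : Matrix (Idx n) (Idx n) ℝ
  b12 : Matrix (Idx n) (Idx n) ℝ
  symm10 : b10.IsSymm
  symm20 : b20.IsSymm
  symm12 : b12.IsSymm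
  identity :
    rename Sum.inl p * rename Sum.inr q - rename Sum.inl q * rename Sum.inr p =
      ∑ i : Idx n, ∑ j : Idx n,
        (C (b10 i j) * (monom xvar i * (xvar 1 * yvar 0 - xvar 0 * yvar 1) * monom yvar j) +
         C (b20 i j) * (monom xvar i * (xvar 2 * yvar 0 - xvar 0 * yvar 2) * monom yvar j) +
         C (b12 i j) * (monom xvar i * (xvar 1 * yvar 2 - xvar 2 * yvar 1) * monom yvar j))

section Spaces

variable {E : Type*} [NormedAddCommGroup E] [InnerProductSpace ℂ E]

/-- The blown up space `W_n`: the Hilbert space of families `(w_{i₁,i₂})`, `i₁ + i₂ ≤ n - 1`,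
of vectors of `E`. -/
abbrev BlownSpace (n : ℕ) (E : Type*) [NormedAddCommGroup E] [InnerProductSpace ℂ E] : Type _ :=
  PiLp 2 (fun _ : Idx n => E)

/-- The multi-index `(a, b)`. -/
abbrev mkIdx {n : ℕ} (a b : ℕ) (h : a + b < n) : Idx n :=
  ⟨(⟨a, by omega⟩, ⟨b, by omega⟩), h⟩

/-- The principal subspace `V_n` of `W_n` attached to the pencil `y₁ σ₂ - y₂ σ₁ + γ`. -/
def principalSubspace (n : ℕ) (σ₁ σ₂ γ : E →L[ℂ] E) : Submodule ℂ (BlownSpace n E) where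
  carrier := {w | ∀ (a b : ℕ) (h : a + b + 1 < n),
    σ₂ (w (mkIdx (a + 1) b (by omega))) - σ₁ (w (mkIdx a (b + 1) (by omega)))
      + γ (w (mkIdx a b (by omega))) = 0}
  zero_mem' := by intro a b h; simp
  add_mem' := by
    intro v w hv hw a b h
    have h1 := hv a b h
    have h2 := hw a b h
    simp only [PiLp.add_apply, map_add]
    rw [← add_zero (0 : E)]
    nth_rewrite 1 [← h1]
    rw [← h2]
    abel
  smul_mem' := by
    intro c w hw a b h
    have h1 := hw a b h
    simp only [PiLp.smul_apply, map_smul]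
    rw [← smul_sub, ← smul_add, h1, smul_zero]

instance principalSubspace.completeSpace [FiniteDimensional ℂ E] (n : ℕ)
    (σ₁ σ₂ γ : E →L[ℂ] E) : CompleteSpace (principalSubspace n σ₁ σ₂ γ) :=
  FiniteDimensional.complete ℂ _

/-- The operator `β ⊗ D` on `W_n`, `((β ⊗ D) w)_i = ∑ j, β_{ij} D w_j`. -/
def tensorOp {n : ℕ} (β : Matrix (Idx n) (Idx n) ℝ) (D : E →L[ℂ] E) :
    BlownSpace n E →L[ℂ] BlownSpace n E :=
  ((PiLp.continuousLinearEquiv 2 ℂ (fun _ : Idx n => E)).symm :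
      (Idx n → E) →L[ℂ] BlownSpace n E) ∘L
    ContinuousLinearMap.pi (fun i => ∑ j : Idx n, ((β i j : ℝ) : ℂ) • (D ∘L PiLp.proj 2 _ j))

/-- The operator `B(p, q) = β¹² ⊗ γ + β¹⁰ ⊗ σ₁ + β²⁰ ⊗ σ₂` on `W_n`. -/
def bezoutBlown {n : ℕ} {p q : MvPolynomial (Fin 3) ℝ} (σ₁ σ₂ γ : E →L[ℂ] E)
    (β : BezoutTriple n p q) : BlownSpace n E →L[ℂ] BlownSpace n E :=
  tensorOp β.b12 γ + tensorOp β.b10 σ₁ + tensorOp β.b20 σ₂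

variable [FiniteDimensional ℂ E]

/-- The Bezout matrix `B'(p, q)` along the curve: the compression of `B(p, q)` to the principal
subspace. -/
def bezout {n : ℕ} {p q : MvPolynomial (Fin 3) ℝ} (σ₁ σ₂ γ : E →L[ℂ] E)
    (β : BezoutTriple n p q) :
    principalSubspace n σ₁ σ₂ γ →L[ℂ] principalSubspace n σ₁ σ₂ γ :=
  (principalSubspace n σ₁ σ₂ γ).orthogonalProjectionOnto ∘L bezoutBlown σ₁ σ₂ γ β ∘L
    (principalSubspace n σ₁ σ₂ γ).subtypeL

end Spaces

section Transform

variable {H E : Type*} [NormedAddCommGroup H] [InnerProductSpace ℂ H] [CompleteSpace H]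
  [NormedAddCommGroup E] [InnerProductSpace ℂ E]

/-- The operator `h ↦ (Φ A₁*^{i₁} A₂*^{i₂} p₀(A₁*, A₂*)⁻¹ h)_{i₁,i₂}` from `H` to `W_n`. -/
def blownΦ (V : Data H E) (n : ℕ) (p₀ : MvPolynomial (Fin 2) ℝ) : H →L[ℂ] BlownSpace n E :=
  ((PiLp.continuousLinearEquiv 2 ℂ (fun _ : Idx n => E)).symm :
      (Idx n → E) →L[ℂ] BlownSpace n E) ∘L
    ContinuousLinearMap.pi (fun i : Idx n =>
      V.Φ ∘L (V.A₁.adjoint ^ (i.1.1 : ℕ) * V.A₂.adjoint ^ (i.1.2 : ℕ) *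
        Ring.inverse (evalOp p₀ V.A₁.adjoint V.A₂.adjoint)))

variable [FiniteDimensional ℂ E]

/-- The space `E' = V_n` of the transformed vessel. -/
abbrev Data.E' (V : Data H E) (n : ℕ) : Type _ := principalSubspace n V.σ₁ V.σ₂ V.γin

/-- The transformed collection `V'`, for the rational map `(p₁ / p₀, p₂ / p₀)` and Bezout
triples for the pairs `(P₁, P₀)`, `(P₂, P₀)`, `(P₁, P₂)`. -/
def Data.transform (V : Data H E) (n : ℕ) (p₀ p₁ p₂ : MvPolynomial (Fin 2) ℝ)
    (β₁ : BezoutTriple n (homogenize n p₁) (homogenize n p₀))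
    (β₂ : BezoutTriple n (homogenize n p₂) (homogenize n p₀))
    (β : BezoutTriple n (homogenize n p₁) (homogenize n p₂)) : Data H (V.E' n) :=
  let Φ' : H →L[ℂ] V.E' n :=
    (principalSubspace n V.σ₁ V.σ₂ V.γin).orthogonalProjectionOnto ∘L blownΦ V n p₀
  let σ₁' : V.E' n →L[ℂ] V.E' n := bezout V.σ₁ V.σ₂ V.γin β₁
  let σ₂' : V.E' n →L[ℂ] V.E' n := bezout V.σ₁ V.σ₂ V.γin β₂
  let γin' : V.E' n →L[ℂ] V.E' n := bezout V.σ₁ V.σ₂ V.γin β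
  { A₁ := evalOp p₁ V.A₁ V.A₂ * Ring.inverse (evalOp p₀ V.A₁ V.A₂)
    A₂ := evalOp p₂ V.A₁ V.A₂ * Ring.inverse (evalOp p₀ V.A₁ V.A₂)
    Φ := Φ'
    σ₁ := σ₁'
    σ₂ := σ₂'
    γin := γin'
    γout := γin' + Complex.I •
      (σ₁' ∘L Φ' ∘L Φ'.adjoint ∘L σ₂' - σ₂' ∘L Φ' ∘L Φ'.adjoint ∘L σ₁') }

end Transform

end Vessel

end

noncomputable section

namespace Vessel

open MvPolynomial

/-! Everything comes from evaluating the Bezout identity on operators. Let `y₁, y₂` act as `A₁*,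
A₂*` on a vector `k`, and send the monomials in `x₁, x₂` to functionals `m a b` on `H`; then
`P(x)Q(y) - Q(x)P(y)` becomes `m_p(q(A*)k) - m_q(p(A*)k)`. Suppose `⟨w_i, σ₁Φ ·⟩` and `⟨w_i, σ₂Φ ·⟩`
are the values of `m` on `(x₁ - y₁)xⁱ` and `(x₂ - y₂)xⁱ`. The input condition then makes `γⁱⁿ`
account for `x₁y₂ - x₂y₁`, so `⟨w, B u⟩` is exactly this difference for `u = (Φ A*ʲ k)_j`
(`inner_bezoutBlown`).

For `w = Φ'h` the functionals `(1/i)⟨p₀(A*)⁻¹h, A₁ᵃA₂ᵇ ·⟩` qualify by the old colligation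
conditions, and the new ones result (`transform_colligation`). For the input condition one pairs
with an arbitrary `v` in `V_n`: the equations defining `V_n` are the compatibility that lets `m` be
constructed (`exists_divided_difference`), and the three Bezout expressions then cancel
(`transform_input`). The output condition and the selfadjointness of `γ'ᵒᵘᵗ` are formal
(`isCommutativeVessel_of_input`).

Bezout triples exist because monomials in `x` and `y` can be exchanged one variable at a time, each
exchange costing a 2×2 minor; symmetrizing the matrices is free (`nonempty_bezoutTriple`). -/

/-! ### Existence of Bezout triples. -/

/-- The polynomial in two groups of variables attached to three real matrices. -/
def bezoutForm (n : ℕ) :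
    (Matrix (Idx n) (Idx n) ℝ × Matrix (Idx n) (Idx n) ℝ × Matrix (Idx n) (Idx n) ℝ) →ₗ[ℝ]
      MvPolynomial (Fin 3 ⊕ Fin 3) ℝ where
  toFun b := ∑ i : Idx n, ∑ j : Idx n,
    (C (b.1 i j) * (monom xvar i * (xvar 1 * yvar 0 - xvar 0 * yvar 1) * monom yvar j) +
     C (b.2.1 i j) * (monom xvar i * (xvar 2 * yvar 0 - xvar 0 * yvar 2) * monom yvar j) +
     C (b.2.2 i j) * (monom xvar i * (xvar 1 * yvar 2 - xvar 2 * yvar 1) * monom yvar j))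
  map_add' b c := by
    simp only [← Finset.sum_add_distrib]
    refine Finset.sum_congr rfl fun i _ => Finset.sum_congr rfl fun j _ => ?_
    simp only [Prod.fst_add, Prod.snd_add, Matrix.add_apply, C_add]
    ring
  map_smul' r b := by
    simp only [Finset.smul_sum]
    refine Finset.sum_congr rfl fun i _ => Finset.sum_congr rfl fun j _ => ?_
    simp only [Prod.smul_fst, Prod.smul_snd, Matrix.smul_apply, smul_eq_mul, C_mul,
      RingHom.id_apply, MvPolynomial.smul_eq_C_mul]
    ring

lemma bezoutForm_apply {n : ℕ} (b : Matrix (Idx n) (Idx n) ℝ × Matrix (Idx n) (Idx n) ℝ ×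
    Matrix (Idx n) (Idx n) ℝ) :
    bezoutForm n b = ∑ i : Idx n, ∑ j : Idx n,
    (C (b.1 i j) * (monom xvar i * (xvar 1 * yvar 0 - xvar 0 * yvar 1) * monom yvar j) +
     C (b.2.1 i j) * (monom xvar i * (xvar 2 * yvar 0 - xvar 0 * yvar 2) * monom yvar j) +
     C (b.2.2 i j) * (monom xvar i * (xvar 1 * yvar 2 - xvar 2 * yvar 1) * monom yvar j)) := rfl

lemma sum_single_mul {ι τ : Type*} [Fintype ι] [DecidableEq ι] (i j : ι)
    (f : ι → ι → MvPolynomial τ ℝ) :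
    ∑ i', ∑ j', C (Matrix.single i j (1 : ℝ) i' j') * f i' j' = f i j := by
  rw [Finset.sum_eq_single i, Finset.sum_eq_single j]
  · simp
  · intro j' _ h
    simp [h.symm]
  · simp
  · intro i' _ h
    simp [h.symm]
  · simp

/-- Matrix units realize the three chosen minors; the other pairs `(k, l)` follow by antisymmetry.
-/
lemma monom_minor_mem {n : ℕ} (i j : Idx n) (k l : Fin 3) :
    monom xvar i * (xvar k * yvar l - xvar l * yvar k) * monom yvar j ∈
      LinearMap.range (bezoutForm n) := by
  have h10 : monom xvar i * (xvar 1 * yvar 0 - xvar 0 * yvar 1) * monom yvar j ∈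
      LinearMap.range (bezoutForm n) := by
    refine ⟨(Matrix.single i j 1, 0, 0), ?_⟩
    rw [bezoutForm_apply]
    simpa using sum_single_mul i j fun i' j' =>
      monom xvar i' * (xvar 1 * yvar 0 - xvar 0 * yvar 1) * monom yvar j'
  have h20 : monom xvar i * (xvar 2 * yvar 0 - xvar 0 * yvar 2) * monom yvar j ∈
      LinearMap.range (bezoutForm n) := by
    refine ⟨(0, Matrix.single i j 1, 0), ?_⟩
    rw [bezoutForm_apply]
    simpa using sum_single_mul i j fun i' j' =>
      monom xvar i' * (xvar 2 * yvar 0 - xvar 0 * yvar 2) * monom yvar j'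
  have h12 : monom xvar i * (xvar 1 * yvar 2 - xvar 2 * yvar 1) * monom yvar j ∈
      LinearMap.range (bezoutForm n) := by
    refine ⟨(0, 0, Matrix.single i j 1), ?_⟩
    rw [bezoutForm_apply]
    simpa using sum_single_mul i j fun i' j' =>
      monom xvar i' * (xvar 1 * yvar 2 - xvar 2 * yvar 1) * monom yvar j'
  have hneg : ∀ k l : Fin 3,
      monom xvar i * (xvar k * yvar l - xvar l * yvar k) * monom yvar j ∈
        LinearMap.range (bezoutForm n) →
      monom xvar i * (xvar l * yvar k - xvar k * yvar l) * monom yvar j ∈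
        LinearMap.range (bezoutForm n) := by
    intro k l h
    convert Submodule.neg_mem _ h using 1
    ring
  have hself : ∀ k : Fin 3,
      monom xvar i * (xvar k * yvar k - xvar k * yvar k) * monom yvar j ∈
        LinearMap.range (bezoutForm n) := by
    intro k
    simp
  fin_cases k <;> fin_cases l
  · exact hself 0
  · exact hneg 1 0 h10
  · exact hneg 2 0 h20
  · exact h10
  · exact hself 1
  · exact h12
  · exact h20
  · exact hneg 1 2 h12
  · exact hself 2

lemma exists_mul_monom {n : ℕ} (R : Type*) [CommRing R] (k : Fin 3) (i : Idx n) :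
    ∃ i' : Idx (n + 1), ∀ z : Fin 3 → R, z k * monom z i = monom z i' := by
  obtain ⟨⟨⟨a, ha⟩, ⟨b, hb⟩⟩, h⟩ := i
  simp only at h
  fin_cases k
  · refine ⟨mkIdx a b (by omega), fun z => ?_⟩
    have e : n + 1 - 1 - (a + b) = n - 1 - (a + b) + 1 := by omega
    simp only [monom, e]
    simp
    ring
  · refine ⟨mkIdx (a + 1) b (by omega), fun z => ?_⟩
    have e : n + 1 - 1 - (a + 1 + b) = n - 1 - (a + b) := by omega
    simp only [monom, e]
    simp
    ring
  · refine ⟨mkIdx a (b + 1) (by omega), fun z => ?_⟩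
    have e : n + 1 - 1 - (a + (b + 1)) = n - 1 - (a + b) := by omega
    simp only [monom, e]
    simp
    ring

lemma exists_prod_eq_monom (R : Type*) [CommRing R] (L : List (Fin 3)) {n : ℕ}
    (hn : L.length = n) :
    ∃ i : Idx (n + 1), ∀ z : Fin 3 → R, (L.map z).prod = monom z i := by
  subst hn
  induction L with
  | nil => exact ⟨mkIdx 0 0 (by simp), fun z => by simp [monom]⟩
  | cons k L ih =>
    obtain ⟨i, hi⟩ := ih
    obtain ⟨i', hi'⟩ := exists_mul_monom R k i
    exact ⟨i', fun z => by rw [List.map_cons, List.prod_cons, hi, hi']⟩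

lemma mul_mem_range_bezoutForm {n : ℕ} (k l : Fin 3) {F : MvPolynomial (Fin 3 ⊕ Fin 3) ℝ}
    (hF : F ∈ LinearMap.range (bezoutForm n)) :
    xvar k * yvar l * F ∈ LinearMap.range (bezoutForm (n + 1)) := by
  obtain ⟨b, rfl⟩ := hF
  rw [bezoutForm_apply, Finset.mul_sum]
  refine Submodule.sum_mem _ fun i _ => ?_
  rw [Finset.mul_sum]
  refine Submodule.sum_mem _ fun j _ => ?_
  obtain ⟨i', hi'⟩ := exists_mul_monom (MvPolynomial (Fin 3 ⊕ Fin 3) ℝ) k i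
  obtain ⟨j', hj'⟩ := exists_mul_monom (MvPolynomial (Fin 3 ⊕ Fin 3) ℝ) l j
  have key : ∀ (c : ℝ) (r s : Fin 3), xvar k * yvar l *
      (C c * (monom xvar i * (xvar r * yvar s - xvar s * yvar r) * monom yvar j)) ∈
      LinearMap.range (bezoutForm (n + 1)) := by
    intro c r s
    have := Submodule.smul_mem _ c (monom_minor_mem i' j' r s)
    rw [← hi', ← hj', MvPolynomial.smul_eq_C_mul] at this
    convert this using 1
    ring
  rw [mul_add, mul_add]
  exact Submodule.add_mem _ (Submodule.add_mem _ (key _ 1 0) (key _ 2 0)) (key _ 1 2)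

/-- Induction on the telescoping identity `x_k X · y_l Y' - x_l X' · y_k Y = x_k y_l (X Y' - X' Y) +
X' (x_k y_l - x_l y_k) Y`, where `X, Y` and `X', Y'` are the products over the two tails. -/
lemma prod_swap_mem (L : List (Fin 3)) : ∀ L' : List (Fin 3), L'.length = L.length →
    (L.map xvar).prod * (L'.map yvar).prod - (L'.map xvar).prod * (L.map yvar).prod ∈
      LinearMap.range (bezoutForm L.length) := by
  induction L with
  | nil =>
    intro L' h
    rw [List.length_nil, List.length_eq_zero_iff] at h
    subst h
    simp
  | cons k L ih =>
    intro L' h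
    cases L' with
    | nil => simp at h
    | cons l L' =>
      have hlen : L'.length = L.length := by simpa using h
      obtain ⟨i, hi⟩ := exists_prod_eq_monom (MvPolynomial (Fin 3 ⊕ Fin 3) ℝ) L' hlen
      obtain ⟨j, hj⟩ := exists_prod_eq_monom (MvPolynomial (Fin 3 ⊕ Fin 3) ℝ) L rfl
      have h1 := mul_mem_range_bezoutForm k l (ih L' hlen)
      have h2 := monom_minor_mem i j k l
      rw [← hi, ← hj] at h2
      rw [List.length_cons]
      convert Submodule.add_mem _ h1 h2 using 1
      simp only [List.map_cons, List.prod_cons]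
      ring

lemma sub_swap_mem_range_bezoutForm {n : ℕ} {p q : MvPolynomial (Fin 2) ℝ}
    (hp : p.totalDegree ≤ n) (hq : q.totalDegree ≤ n) :
    rename Sum.inl (homogenize n p) * rename Sum.inr (homogenize n q) -
      rename Sum.inl (homogenize n q) * rename Sum.inr (homogenize n p) ∈
        LinearMap.range (bezoutForm n) := by
  have hdeg : ∀ {r : MvPolynomial (Fin 2) ℝ} {m : Fin 2 →₀ ℕ}, r.totalDegree ≤ n →
      m ∈ r.support → m 0 + m 1 ≤ n := by
    intro r m hr hm
    have := (le_totalDegree hm).trans hr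
    rwa [Finsupp.sum_fintype _ _ (fun _ => rfl), Fin.sum_univ_two] at this
  simp only [homogenize, map_sum, map_mul, map_pow, rename_C, rename_X, Finset.sum_mul_sum]
  rw [Finset.sum_comm (s := q.support), ← Finset.sum_sub_distrib]
  refine Submodule.sum_mem _ fun m hm => ?_
  rw [← Finset.sum_sub_distrib]
  refine Submodule.sum_mem _ fun m' hm' => ?_
  have h1 := hdeg hp hm
  have h2 := hdeg hq hm'
  -- A homogenized monomial spelled out as a word of length exactly `n`; the degree bound keeps the
  -- subtraction from truncating.
  let L (m : Fin 2 →₀ ℕ) : List (Fin 3) := List.replicate (n - (m 0 + m 1)) 0 ++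
    List.replicate (m 0) 1 ++ List.replicate (m 1) 2
  have hL : (L m).length = n := by simp [L]; omega
  have hL' : (L m').length = n := by simp [L]; omega
  have h := prod_swap_mem (L m) (L m') (hL'.trans hL.symm)
  rw [hL] at h
  convert Submodule.smul_mem _ (p.coeff m * q.coeff m') h using 1
  simp only [L, List.map_append, List.map_replicate, List.prod_append, List.prod_replicate,
    MvPolynomial.smul_eq_C_mul, C_mul, xvar, yvar]
  ring

/-- Each minor changes sign when `x` and `y` trade places, while the outer monomials trade row and
column indices. -/
lemma rename_swap_bezoutForm {n : ℕ} (b : Matrix (Idx n) (Idx n) ℝ ×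
    Matrix (Idx n) (Idx n) ℝ × Matrix (Idx n) (Idx n) ℝ) :
    rename Sum.swap (bezoutForm n b) =
      -bezoutForm n (b.1.transpose, b.2.1.transpose, b.2.2.transpose) := by
  have hx : ∀ k, rename Sum.swap (xvar k) = yvar k := fun k => by simp [xvar, yvar]
  have hy : ∀ k, rename Sum.swap (yvar k) = xvar k := fun k => by simp [xvar, yvar]
  have hmx : ∀ i : Idx n, rename Sum.swap (monom xvar i) = monom yvar i := fun i => by
    simp [monom, hx]
  have hmy : ∀ i : Idx n, rename Sum.swap (monom yvar i) = monom xvar i := fun i => by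
    simp [monom, hy]
  rw [bezoutForm_apply, bezoutForm_apply, Finset.sum_comm, ← Finset.sum_neg_distrib, map_sum]
  refine Finset.sum_congr rfl fun i _ => ?_
  rw [← Finset.sum_neg_distrib, map_sum]
  refine Finset.sum_congr rfl fun j _ => ?_
  simp only [map_add, map_sub, map_mul, hx, hy, hmx, hmy, rename_C, Matrix.transpose_apply]
  ring

/-- Two real polynomials of degree at most `n` have a Bezout triple. -/
theorem nonempty_bezoutTriple {n : ℕ} {p q : MvPolynomial (Fin 2) ℝ}
    (hp : p.totalDegree ≤ n) (hq : q.totalDegree ≤ n) :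
    Nonempty (BezoutTriple n (homogenize n p) (homogenize n q)) := by
  obtain ⟨b, hb⟩ := sub_swap_mem_range_bezoutForm hp hq
  set F := rename Sum.inl (homogenize n p) * rename Sum.inr (homogenize n q) -
      rename Sum.inl (homogenize n q) * rename Sum.inr (homogenize n p) with hF
  have hswap : rename Sum.swap F = -F := by
    have e1 : (Sum.swap ∘ Sum.inl : Fin 3 → Fin 3 ⊕ Fin 3) = Sum.inr := rfl
    have e2 : (Sum.swap ∘ Sum.inr : Fin 3 → Fin 3 ⊕ Fin 3) = Sum.inl := rfl
    rw [hF]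
    simp only [map_sub, map_mul, rename_rename, e1, e2]
    ring
  have ht : bezoutForm n (b.1.transpose, b.2.1.transpose, b.2.2.transpose) = F := by
    rw [← neg_inj, ← rename_swap_bezoutForm, hb, hswap]
  -- The antisymmetry of `F` shows that the transposed matrices represent it too, so their average
  -- with the original ones does as well and is symmetric.
  have hs : F = bezoutForm n ((1 / 2 : ℝ) •
      (b + (b.1.transpose, b.2.1.transpose, b.2.2.transpose))) := by
    rw [map_smul, map_add, hb, ht, ← two_smul ℝ F, smul_smul]
    norm_num
  refine ⟨⟨(1 / 2 : ℝ) • (b.1 + b.1.transpose), (1 / 2 : ℝ) • (b.2.1 + b.2.1.transpose),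
    (1 / 2 : ℝ) • (b.2.2 + b.2.2.transpose), ?_, ?_, ?_, hs⟩⟩
  all_goals
    rw [Matrix.IsSymm, Matrix.transpose_smul, Matrix.transpose_add, Matrix.transpose_transpose,
      add_comm]

/-! ### Evaluation of the Bezout identity on operators. -/

section Evaluation

variable {H E : Type*} [NormedAddCommGroup H] [InnerProductSpace ℂ H]
  [NormedAddCommGroup E] [InnerProductSpace ℂ E]

/-- The real linear functional sending `x ^ a * y ^ b` to `m a₁ a₂ (S ^ b₁ T ^ b₂ k)`. -/
def pairFunctional (m : ℕ → ℕ → H →L[ℂ] ℂ) (S T : H →L[ℂ] H) (k : H) :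
    MvPolynomial (Fin 3 ⊕ Fin 3) ℝ →ₗ[ℝ] ℂ :=
  (basisMonomials (Fin 3 ⊕ Fin 3) ℝ).constr ℝ fun e =>
    -- The exponents of `x₀` and `y₀` are ignored, which amounts to setting `x₀ = y₀ = 1`.
    m (e (Sum.inl 1)) (e (Sum.inl 2)) ((S ^ e (Sum.inr 1) * T ^ e (Sum.inr 2)) k)

lemma pairFunctional_monomial (m : ℕ → ℕ → H →L[ℂ] ℂ) (S T : H →L[ℂ] H) (k : H)
    (a₀ a₁ a₂ b₀ b₁ b₂ : ℕ) :
    pairFunctional m S T k (xvar 0 ^ a₀ * xvar 1 ^ a₁ * xvar 2 ^ a₂ *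
      (yvar 0 ^ b₀ * yvar 1 ^ b₁ * yvar 2 ^ b₂)) = m a₁ a₂ ((S ^ b₁ * T ^ b₂) k) := by
  set e : Fin 3 ⊕ Fin 3 →₀ ℕ := Finsupp.single (Sum.inl 0) a₀ + Finsupp.single (Sum.inl 1) a₁ +
    Finsupp.single (Sum.inl 2) a₂ + (Finsupp.single (Sum.inr 0) b₀ +
      Finsupp.single (Sum.inr 1) b₁ + Finsupp.single (Sum.inr 2) b₂) with he
  have h : (xvar 0 ^ a₀ * xvar 1 ^ a₁ * xvar 2 ^ a₂ *
      (yvar 0 ^ b₀ * yvar 1 ^ b₁ * yvar 2 ^ b₂)) = basisMonomials (Fin 3 ⊕ Fin 3) ℝ e := by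
    simp only [xvar, yvar, X_pow_eq_monomial, monomial_mul, coe_basisMonomials, he, mul_one]
  rw [h, pairFunctional, Module.Basis.constr_basis]
  simp [he]

lemma pairFunctional_minor₁ (m : ℕ → ℕ → H →L[ℂ] ℂ) {S T : H →L[ℂ] H} (k : H)
    {n : ℕ} (i j : Idx n) :
    pairFunctional m S T k
      (monom xvar i * (xvar 1 * yvar 0 - xvar 0 * yvar 1) * monom yvar j) =
    m (i.1.1 + 1) i.1.2 ((S ^ (j.1.1 : ℕ) * T ^ (j.1.2 : ℕ)) k) -
      m i.1.1 i.1.2 (S ((S ^ (j.1.1 : ℕ) * T ^ (j.1.2 : ℕ)) k)) := by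
  rw [← mul_apply_eq_comp S, ← mul_assoc, ← pow_succ',
    ← pairFunctional_monomial m S T k (n - 1 - (i.1.1 + i.1.2)) _ _ (n - 1 - (j.1.1 + j.1.2) + 1),
    ← pairFunctional_monomial m S T k (n - 1 - (i.1.1 + i.1.2) + 1) _ _ (n - 1 - (j.1.1 + j.1.2)),
    ← map_sub]
  congr 1
  simp only [monom]
  ring

lemma pairFunctional_minor₂ (m : ℕ → ℕ → H →L[ℂ] ℂ) {S T : H →L[ℂ] H} (hST : Commute S T)
    (k : H) {n : ℕ} (i j : Idx n) :
    pairFunctional m S T k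
      (monom xvar i * (xvar 2 * yvar 0 - xvar 0 * yvar 2) * monom yvar j) =
    m i.1.1 (i.1.2 + 1) ((S ^ (j.1.1 : ℕ) * T ^ (j.1.2 : ℕ)) k) -
      m i.1.1 i.1.2 (T ((S ^ (j.1.1 : ℕ) * T ^ (j.1.2 : ℕ)) k)) := by
  rw [← mul_apply_eq_comp T, ← mul_assoc, ← (hST.pow_left _).eq, mul_assoc (S ^ _),
    ← pow_succ',
    ← pairFunctional_monomial m S T k (n - 1 - (i.1.1 + i.1.2)) _ _ (n - 1 - (j.1.1 + j.1.2) + 1),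
    ← pairFunctional_monomial m S T k (n - 1 - (i.1.1 + i.1.2) + 1) _ _ (n - 1 - (j.1.1 + j.1.2)),
    ← map_sub]
  congr 1
  simp only [monom]
  ring

lemma pairFunctional_minor₁₂ (m : ℕ → ℕ → H →L[ℂ] ℂ) {S T : H →L[ℂ] H} (hST : Commute S T)
    (k : H) {n : ℕ} (i j : Idx n) :
    pairFunctional m S T k
      (monom xvar i * (xvar 1 * yvar 2 - xvar 2 * yvar 1) * monom yvar j) =
    m (i.1.1 + 1) i.1.2 (T ((S ^ (j.1.1 : ℕ) * T ^ (j.1.2 : ℕ)) k)) -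
      m i.1.1 (i.1.2 + 1) (S ((S ^ (j.1.1 : ℕ) * T ^ (j.1.2 : ℕ)) k)) := by
  rw [← mul_apply_eq_comp T, ← mul_assoc, ← (hST.pow_left _).eq, mul_assoc (S ^ _),
    ← pow_succ', ← mul_apply_eq_comp S, ← mul_assoc, ← pow_succ',
    ← pairFunctional_monomial m S T k (n - 1 - (i.1.1 + i.1.2)) _ _ (n - 1 - (j.1.1 + j.1.2)),
    ← pairFunctional_monomial m S T k (n - 1 - (i.1.1 + i.1.2)) _ _ (n - 1 - (j.1.1 + j.1.2)),
    ← map_sub]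
  congr 1
  simp only [monom]
  ring

/-- The functional `p(m) = ∑ coeff • m`. -/
def evalFunctional (m : ℕ → ℕ → H →L[ℂ] ℂ) (p : MvPolynomial (Fin 2) ℝ) : H →L[ℂ] ℂ :=
  ∑ e ∈ p.support, ((p.coeff e : ℝ) : ℂ) • m (e 0) (e 1)

lemma pairFunctional_mul (m : ℕ → ℕ → H →L[ℂ] ℂ) (S T : H →L[ℂ] H) (k : H) (n : ℕ)
    (p q : MvPolynomial (Fin 2) ℝ) :
    pairFunctional m S T k
      (rename Sum.inl (homogenize n p) * rename Sum.inr (homogenize n q)) =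
    evalFunctional m p (evalOp q S T k) := by
  simp only [homogenize, map_sum, map_mul, map_pow, rename_C, rename_X, Finset.sum_mul_sum,
    evalFunctional, evalOp, sum_apply]
  rw [Finset.sum_comm]
  refine Finset.sum_congr rfl fun f _ => Finset.sum_congr rfl fun e _ => ?_
  have h := pairFunctional_monomial m S T k (n - (e 0 + e 1)) (e 0) (e 1)
    (n - (f 0 + f 1)) (f 0) (f 1)
  rw [smul_apply, smul_apply, map_smul, ← h, smul_smul,
    ← Complex.ofReal_mul, Complex.coe_smul, ← map_smul, MvPolynomial.smul_eq_C_mul, C_mul]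
  congr 1
  simp only [xvar, yvar]
  ring

lemma pairFunctional_bezout (m : ℕ → ℕ → H →L[ℂ] ℂ) {S T : H →L[ℂ] H} (hST : Commute S T)
    (k : H) {n : ℕ} {p q : MvPolynomial (Fin 2) ℝ}
    (β : BezoutTriple n (homogenize n p) (homogenize n q)) :
    evalFunctional m p (evalOp q S T k) - evalFunctional m q (evalOp p S T k) =
    ∑ i : Idx n, ∑ j : Idx n,
      ((β.b10 i j : ℂ) * (m (i.1.1 + 1) i.1.2 ((S ^ (j.1.1 : ℕ) * T ^ (j.1.2 : ℕ)) k) -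
          m i.1.1 i.1.2 (S ((S ^ (j.1.1 : ℕ) * T ^ (j.1.2 : ℕ)) k))) +
        (β.b20 i j : ℂ) * (m i.1.1 (i.1.2 + 1) ((S ^ (j.1.1 : ℕ) * T ^ (j.1.2 : ℕ)) k) -
          m i.1.1 i.1.2 (T ((S ^ (j.1.1 : ℕ) * T ^ (j.1.2 : ℕ)) k))) +
        (β.b12 i j : ℂ) * (m (i.1.1 + 1) i.1.2 (T ((S ^ (j.1.1 : ℕ) * T ^ (j.1.2 : ℕ)) k)) -
          m i.1.1 (i.1.2 + 1) (S ((S ^ (j.1.1 : ℕ) * T ^ (j.1.2 : ℕ)) k)))) := by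
  rw [← pairFunctional_mul m S T k n p q, ← pairFunctional_mul m S T k n q p, ← map_sub,
    β.identity]
  simp only [map_sum, map_add, ← MvPolynomial.smul_eq_C_mul, map_smul, pairFunctional_minor₁,
    pairFunctional_minor₂ m hST, pairFunctional_minor₁₂ m hST, Complex.real_smul]

lemma tensorOp_apply {n : ℕ} (β : Matrix (Idx n) (Idx n) ℝ) (D : E →L[ℂ] E)
    (w : BlownSpace n E) (i : Idx n) :
    tensorOp β D w i = ∑ j : Idx n, ((β i j : ℝ) : ℂ) • D (w j) := by
  simp [tensorOp]

lemma bezoutBlown_apply {n : ℕ} {p q : MvPolynomial (Fin 3) ℝ} (σ₁ σ₂ γ : E →L[ℂ] E)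
    (β : BezoutTriple n p q) (w : BlownSpace n E) (i : Idx n) :
    bezoutBlown σ₁ σ₂ γ β w i = ∑ j : Idx n, (((β.b10 i j : ℝ) : ℂ) • σ₁ (w j) +
      ((β.b20 i j : ℝ) : ℂ) • σ₂ (w j) + ((β.b12 i j : ℝ) : ℂ) • γ (w j)) := by
  simp only [bezoutBlown, add_apply, PiLp.add_apply, tensorOp_apply,
    Finset.sum_add_distrib]
  abel

/-- Evaluation of the Bezout form between a vector `w` and the family `(Φ S^{j₁} T^{j₂} k)`. -/
lemma inner_bezoutBlown {σ₁ σ₂ γ : E →L[ℂ] E} {Φ : H →L[ℂ] E} {S T : H →L[ℂ] H}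
    (hST : Commute S T) (hin : ∀ x, γ (Φ x) = σ₁ (Φ (T x)) - σ₂ (Φ (S x)))
    {n : ℕ} {p q : MvPolynomial (Fin 2) ℝ}
    (β : BezoutTriple n (homogenize n p) (homogenize n q)) {w u : BlownSpace n E}
    {m : ℕ → ℕ → H →L[ℂ] ℂ} {k : H}
    (h₁ : ∀ (i : Idx n) x, inner ℂ (w i) (σ₁ (Φ x)) =
      m (i.1.1 + 1) i.1.2 x - m i.1.1 i.1.2 (S x))
    (h₂ : ∀ (i : Idx n) x, inner ℂ (w i) (σ₂ (Φ x)) =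
      m i.1.1 (i.1.2 + 1) x - m i.1.1 i.1.2 (T x))
    (hu : ∀ j : Idx n, u j = Φ ((S ^ (j.1.1 : ℕ) * T ^ (j.1.2 : ℕ)) k)) :
    inner ℂ w (bezoutBlown σ₁ σ₂ γ β u) =
      evalFunctional m p (evalOp q S T k) - evalFunctional m q (evalOp p S T k) := by
  rw [pairFunctional_bezout m hST k β, PiLp.inner_apply]
  refine Finset.sum_congr rfl fun i _ => ?_
  rw [bezoutBlown_apply, inner_sum]
  refine Finset.sum_congr rfl fun j _ => ?_
  -- The `γ` term matches because `(x₁ - y₁)y₂ - (x₂ - y₂)y₁ = x₁y₂ - x₂y₁`, which uses `y₁y₂ =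
  -- y₂y₁`.
  have hcomm : ∀ x, S (T x) = T (S x) := fun x => DFunLike.congr_fun hST.eq x
  rw [inner_add_right, inner_add_right, inner_smul_right, inner_smul_right, inner_smul_right,
    hu, hin, inner_sub_right, h₁, h₁, h₂, h₂, hcomm]
  ring

/-- Divided differences: a functional `m` with `m ((x₁ - y₁) f) = ℓ₁ f`, `m ((x₂ - y₂) f) = ℓ₂ f`
for `f` of degree less than `n` in `x`, for a compatible pair `ℓ₁`, `ℓ₂`. -/
lemma exists_divided_difference {S T : H →L[ℂ] H} (hST : Commute S T) (n : ℕ)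
    (l₁ l₂ : ℕ → ℕ → H →L[ℂ] ℂ)
    (hl : ∀ a b, a + b + 1 < n → ∀ x,
      l₂ (a + 1) b x - l₂ a b (S x) = l₁ a (b + 1) x - l₁ a b (T x)) :
    ∃ m : ℕ → ℕ → H →L[ℂ] ℂ, ∀ a b, a + b < n → ∀ x,
      l₁ a b x = m (a + 1) b x - m a b (S x) ∧ l₂ a b x = m a (b + 1) x - m a b (T x) := by
  have hT : ∀ (r : ℕ) x, (S ^ r) (T x) = T ((S ^ r) x) := fun r x =>
    DFunLike.congr_fun (hST.pow_left r).eq x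
  have hS : ∀ (r : ℕ) x, (S ^ r) (S x) = (S ^ (r + 1)) x := fun r x => by
    rw [pow_succ]; rfl
  have hS' : ∀ (r : ℕ) x, S ((S ^ r) x) = (S ^ (r + 1)) x := fun r x => by
    rw [pow_succ']; rfl
  have hT' : ∀ (r : ℕ) x, (T ^ r) (T x) = (T ^ (r + 1)) x := fun r x => by
    rw [pow_succ]; rfl
  have hTS : ∀ (r : ℕ) x, (T ^ r) (S x) = S ((T ^ r) x) := fun r x =>
    (DFunLike.congr_fun (hST.pow_right r).eq x).symm
  -- With the normalization `m 0 0 = 0`, this is forced by `x₁ᵃx₂ᵇ - y₁ᵃy₂ᵇ = (x₁ᵃ - y₁ᵃ)x₂ᵇ +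
  -- y₁ᵃ(x₂ᵇ - y₂ᵇ)`, each difference of powers being expanded geometrically. The equation for `l₁`
  -- is then automatic; only the one for `l₂` needs compatibility.
  refine ⟨fun a b => (∑ s ∈ Finset.range a, l₁ s b ∘L S ^ (a - 1 - s)) +
    ∑ t ∈ Finset.range b, l₂ 0 t ∘L (S ^ a * T ^ (b - 1 - t)), fun a b hab x => ⟨?_, ?_⟩⟩
  · simp only [add_apply, sum_apply,
      ContinuousLinearMap.comp_apply, mul_apply_eq_comp]
    rw [Finset.sum_range_succ]
    have e₁ : ∑ s ∈ Finset.range a, l₁ s b ((S ^ (a + 1 - 1 - s)) x) =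
        ∑ s ∈ Finset.range a, l₁ s b ((S ^ (a - 1 - s)) (S x)) := by
      refine Finset.sum_congr rfl fun s hs => ?_
      rw [Finset.mem_range] at hs
      rw [hS, show a - 1 - s + 1 = a + 1 - 1 - s by omega]
    have e₂ : ∑ t ∈ Finset.range b, l₂ 0 t ((S ^ a) ((T ^ (b - 1 - t)) (S x))) =
        ∑ t ∈ Finset.range b, l₂ 0 t ((S ^ (a + 1)) ((T ^ (b - 1 - t)) x)) := by
      refine Finset.sum_congr rfl fun t _ => ?_
      rw [hTS, hS]
    rw [e₁, e₂]
    simp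
  · simp only [add_apply, sum_apply,
      ContinuousLinearMap.comp_apply, mul_apply_eq_comp]
    rw [Finset.sum_range_succ (n := b)]
    have e₂ : ∑ t ∈ Finset.range b, l₂ 0 t ((S ^ a) ((T ^ (b + 1 - 1 - t)) x)) =
        ∑ t ∈ Finset.range b, l₂ 0 t ((S ^ a) ((T ^ (b - 1 - t)) (T x))) := by
      refine Finset.sum_congr rfl fun t ht => ?_
      rw [Finset.mem_range] at ht
      rw [hT', show b - 1 - t + 1 = b + 1 - 1 - t by omega]
    -- Compatibility turns each summand into a difference of consecutive values of `l₂ s b (S ^ (a -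
    -- s) x)`, so the sum telescopes.
    have e₁ : ∑ s ∈ Finset.range a, l₁ s (b + 1) ((S ^ (a - 1 - s)) x) -
        ∑ s ∈ Finset.range a, l₁ s b ((S ^ (a - 1 - s)) (T x)) =
        l₂ a b x - l₂ 0 b ((S ^ a) x) := by
      have := Finset.sum_range_sub (fun s => l₂ s b ((S ^ (a - s)) x)) a
      simp only [Nat.sub_self, pow_zero, Nat.sub_zero, one_apply_eq_self] at this
      rw [← this, ← Finset.sum_sub_distrib]
      refine Finset.sum_congr rfl fun s hs => ?_
      rw [Finset.mem_range] at hs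
      have h := hl s b (by omega) ((S ^ (a - 1 - s)) x)
      rw [hS', show a - 1 - s + 1 = a - s by omega] at h
      rw [hT, ← h, show a - (s + 1) = a - 1 - s by omega]
    rw [e₂]
    simp only [Nat.add_sub_cancel, Nat.sub_self, pow_zero, one_apply_eq_self]
    linear_combination -e₁

end Evaluation

/-! ### Commutation and adjoints of polynomials in operators. -/

section Algebra

variable {H : Type*} [NormedAddCommGroup H] [InnerProductSpace ℂ H]

lemma commute_evalOp {X S T : H →L[ℂ] H} (hS : Commute X S) (hT : Commute X T)
    (p : MvPolynomial (Fin 2) ℝ) : Commute X (evalOp p S T) :=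
  Commute.sum_right _ _ _ fun _ _ =>
    ((hS.pow_right _).mul_right (hT.pow_right _)).smul_right _

lemma commute_evalOp_evalOp {S T : H →L[ℂ] H} (h : Commute S T)
    (p q : MvPolynomial (Fin 2) ℝ) : Commute (evalOp p S T) (evalOp q S T) :=
  commute_evalOp (commute_evalOp (Commute.refl S) h p).symm
    (commute_evalOp h.symm (Commute.refl T) p).symm q

lemma commute_ringInverse_right {R : Type*} [Ring R] {a b : R} (hb : IsUnit b)
    (h : Commute a b) : Commute a (Ring.inverse b) := by
  obtain ⟨u, rfl⟩ := hb
  rw [Ring.inverse_unit]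
  exact h.units_inv_right

variable [CompleteSpace H]

lemma adjoint_evalOp {S T : H →L[ℂ] H} (h : Commute S T) (p : MvPolynomial (Fin 2) ℝ) :
    (evalOp p S T).adjoint = evalOp p S.adjoint T.adjoint := by
  simp only [← ContinuousLinearMap.star_eq_adjoint, evalOp, star_sum, star_smul, star_mul,
    star_pow]
  refine Finset.sum_congr rfl fun m _ => ?_
  rw [(h.star_star.pow_pow _ _).eq]
  simp

end Algebra

/-! ### Compression to the principal subspace. -/

section Compression

variable {E : Type*} [NormedAddCommGroup E] [InnerProductSpace ℂ E]

lemma inner_tensorOp_comm {n : ℕ} {β : Matrix (Idx n) (Idx n) ℝ} (hβ : β.IsSymm)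
    {D : E →L[ℂ] E} (hD : ∀ x y, inner ℂ (D x) y = inner ℂ x (D y)) (u w : BlownSpace n E) :
    inner ℂ (tensorOp β D u) w = inner ℂ u (tensorOp β D w) := by
  simp only [PiLp.inner_apply, tensorOp_apply, sum_inner, inner_sum, inner_smul_left,
    inner_smul_right, hD, Complex.conj_ofReal]
  rw [Finset.sum_comm]
  simp only [hβ.apply]

variable [FiniteDimensional ℂ E]

/-- The projection is invisible to vectors of `V_n`, so computations can be carried out in `W_n`. -/
lemma inner_bezout_left {n : ℕ} {p q : MvPolynomial (Fin 3) ℝ} {σ₁ σ₂ γ : E →L[ℂ] E}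
    (β : BezoutTriple n p q) (v u : principalSubspace n σ₁ σ₂ γ) :
    inner ℂ v (bezout σ₁ σ₂ γ β u) =
      inner ℂ (v : BlownSpace n E) (bezoutBlown σ₁ σ₂ γ β (u : BlownSpace n E)) := by
  change inner ℂ v (Submodule.orthogonalProjectionOnto _ (bezoutBlown σ₁ σ₂ γ β u)) = _
  rw [Submodule.inner_orthogonalProjectionOnto_eq_of_mem_left]

variable [CompleteSpace E]

lemma isSelfAdjoint_bezout {n : ℕ} {p q : MvPolynomial (Fin 3) ℝ} {σ₁ σ₂ γ : E →L[ℂ] E}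
    (h₁ : IsSelfAdjoint σ₁) (h₂ : IsSelfAdjoint σ₂) (hγ : IsSelfAdjoint γ)
    (β : BezoutTriple n p q) : IsSelfAdjoint (bezout σ₁ σ₂ γ β) := by
  rw [ContinuousLinearMap.isSelfAdjoint_iff_isSymmetric] at h₁ h₂ hγ ⊢
  intro v w
  change inner ℂ (Submodule.orthogonalProjectionOnto _ (bezoutBlown σ₁ σ₂ γ β v)) w =
    inner ℂ v (Submodule.orthogonalProjectionOnto _ (bezoutBlown σ₁ σ₂ γ β w))
  rw [Submodule.inner_orthogonalProjectionOnto_eq_of_mem_left,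
    Submodule.inner_orthogonalProjectionOnto_eq_of_mem_right]
  simp only [bezoutBlown, add_apply, inner_add_left, inner_add_right,
    inner_tensorOp_comm β.symm12 hγ, inner_tensorOp_comm β.symm10 h₁,
    inner_tensorOp_comm β.symm20 h₂]

end Compression

/-! ### Redundant vessel conditions. -/

/-- The selfadjointness of `γᵒᵘᵗ` and the output condition follow from the other conditions of a
commutative vessel. -/
lemma isCommutativeVessel_of_input {H E : Type*}
    [NormedAddCommGroup H] [InnerProductSpace ℂ H] [CompleteSpace H]
    [NormedAddCommGroup E] [InnerProductSpace ℂ E] [CompleteSpace E] {V : Data H E}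
    (commute : V.A₁ ∘L V.A₂ = V.A₂ ∘L V.A₁)
    (h₁ : IsSelfAdjoint V.σ₁) (h₂ : IsSelfAdjoint V.σ₂) (hγ : IsSelfAdjoint V.γin)
    (c₁ : V.Φ.adjoint ∘L V.σ₁ ∘L V.Φ = (1 / Complex.I) • (V.A₁ - V.A₁.adjoint))
    (c₂ : V.Φ.adjoint ∘L V.σ₂ ∘L V.Φ = (1 / Complex.I) • (V.A₂ - V.A₂.adjoint))
    (input : V.γin ∘L V.Φ = V.σ₁ ∘L V.Φ ∘L V.A₂.adjoint - V.σ₂ ∘L V.Φ ∘L V.A₁.adjoint)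
    (linkage : V.γout = V.γin + Complex.I •
      (V.σ₁ ∘L V.Φ ∘L V.Φ.adjoint ∘L V.σ₂ - V.σ₂ ∘L V.Φ ∘L V.Φ.adjoint ∘L V.σ₁)) :
    V.IsCommutativeVessel where
  commute := commute
  σ₁_selfAdjoint := h₁
  σ₂_selfAdjoint := h₂
  γin_selfAdjoint := hγ
  γout_selfAdjoint := by
    rw [ContinuousLinearMap.isSelfAdjoint_iff'] at h₁ h₂ hγ ⊢
    rw [linkage]
    simp only [map_add, map_sub, map_smulₛₗ, ContinuousLinearMap.adjoint_comp,
      ContinuousLinearMap.adjoint_adjoint, h₁, h₂, hγ, Complex.conj_I,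
      ContinuousLinearMap.comp_assoc]
    rw [neg_smul, ← smul_neg, neg_sub]
  colligation₁ := c₁
  colligation₂ := c₂
  input := input
  output := by
    ext k
    have c₁' := DFunLike.congr_fun c₁ k
    have c₂' := DFunLike.congr_fun c₂ k
    have hk := DFunLike.congr_fun input k
    simp only [ContinuousLinearMap.comp_apply, sub_apply, smul_apply] at c₁' c₂' hk
    -- In the linkage term, `i Φ*σ_kΦ = A_k - A_k*` replaces each `A_k*` of the input condition by
    -- `A_k`.
    simp only [linkage, ContinuousLinearMap.comp_apply, sub_apply, smul_apply, add_apply, hk,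
      c₁', c₂', map_smul, map_sub, ← smul_sub, smul_smul]
    rw [mul_one_div_cancel Complex.I_ne_zero, one_smul]
    abel
  linkage := linkage

/-! ### The transformed vessel. -/

section Transform

variable {H E : Type*} [NormedAddCommGroup H] [InnerProductSpace ℂ H] [CompleteSpace H]
  [NormedAddCommGroup E] [InnerProductSpace ℂ E]

lemma blownΦ_apply (V : Data H E) (n : ℕ) (p₀ : MvPolynomial (Fin 2) ℝ) (h : H) (j : Idx n) :
    blownΦ V n p₀ h j = V.Φ ((V.A₁.adjoint ^ (j.1.1 : ℕ) * V.A₂.adjoint ^ (j.1.2 : ℕ))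
      (Ring.inverse (evalOp p₀ V.A₁.adjoint V.A₂.adjoint) h)) := by
  simp [blownΦ]

variable [CompleteSpace E]

lemma Data.IsCommutativeVessel.commute_adjoint {V : Data H E} (hV : V.IsCommutativeVessel) :
    Commute V.A₁.adjoint V.A₂.adjoint :=
  Commute.star_star (x := V.A₁) (y := V.A₂) hV.commute

lemma Data.IsCommutativeVessel.input_apply {V : Data H E} (hV : V.IsCommutativeVessel) (x : H) :
    V.γin (V.Φ x) = V.σ₁ (V.Φ (V.A₂.adjoint x)) - V.σ₂ (V.Φ (V.A₁.adjoint x)) :=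
  DFunLike.congr_fun hV.input x

lemma Data.IsCommutativeVessel.inner_σ₁ {V : Data H E} (hV : V.IsCommutativeVessel) (x y : H) :
    inner ℂ (V.Φ x) (V.σ₁ (V.Φ y)) =
      (1 / Complex.I) * (inner ℂ x (V.A₁ y) - inner ℂ x (V.A₁.adjoint y)) := by
  have := DFunLike.congr_fun hV.colligation₁ y
  simp only [ContinuousLinearMap.comp_apply, smul_apply, sub_apply] at this
  rw [← ContinuousLinearMap.adjoint_inner_right, this, inner_smul_right, inner_sub_right]

lemma Data.IsCommutativeVessel.inner_σ₂ {V : Data H E} (hV : V.IsCommutativeVessel) (x y : H) :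
    inner ℂ (V.Φ x) (V.σ₂ (V.Φ y)) =
      (1 / Complex.I) * (inner ℂ x (V.A₂ y) - inner ℂ x (V.A₂.adjoint y)) := by
  have := DFunLike.congr_fun hV.colligation₂ y
  simp only [ContinuousLinearMap.comp_apply, smul_apply, sub_apply] at this
  rw [← ContinuousLinearMap.adjoint_inner_right, this, inner_smul_right, inner_sub_right]

lemma adjoint_div {V : Data H E} (hV : V.IsCommutativeVessel) (p p₀ : MvPolynomial (Fin 2) ℝ) :
    (evalOp p V.A₁ V.A₂ * Ring.inverse (evalOp p₀ V.A₁ V.A₂)).adjoint =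
      Ring.inverse (evalOp p₀ V.A₁.adjoint V.A₂.adjoint) *
        evalOp p V.A₁.adjoint V.A₂.adjoint := by
  have hA : Commute V.A₁ V.A₂ := hV.commute
  rw [← adjoint_evalOp hA, ← adjoint_evalOp hA]
  simp only [← ContinuousLinearMap.star_eq_adjoint]
  rw [star_mul, Ring.inverse_star]

lemma isUnit_evalOp_adjoint {V : Data H E} (hV : V.IsCommutativeVessel)
    {p₀ : MvPolynomial (Fin 2) ℝ} (hp₀ : IsUnit (evalOp p₀ V.A₁ V.A₂)) :
    IsUnit (evalOp p₀ V.A₁.adjoint V.A₂.adjoint) := by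
  rw [← adjoint_evalOp hV.commute, ← ContinuousLinearMap.star_eq_adjoint]
  exact hp₀.star

/-- The equations of `V_n` are the input condition at the vectors `A₁*ᵃ A₂*ᵇ p₀(A*)⁻¹ h`. Hence the
projection in `Φ'` does nothing. -/
lemma blownΦ_mem {V : Data H E} (hV : V.IsCommutativeVessel) (n : ℕ)
    (p₀ : MvPolynomial (Fin 2) ℝ) (h : H) :
    blownΦ V n p₀ h ∈ principalSubspace n V.σ₁ V.σ₂ V.γin := by
  intro a b hab
  have hc := hV.commute_adjoint
  simp only [blownΦ_apply, hV.input_apply]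
  rw [← mul_apply_eq_comp V.A₁.adjoint, ← mul_apply_eq_comp V.A₂.adjoint,
    ← mul_assoc, ← mul_assoc, ← pow_succ', ← (hc.pow_left a).eq, mul_assoc (_ ^ a), ← pow_succ']
  abel

variable [FiniteDimensional ℂ E]

/-- The operator `Φ'` of the transformed vessel. -/
def transformΦ (V : Data H E) (n : ℕ) (p₀ : MvPolynomial (Fin 2) ℝ) : H →L[ℂ] V.E' n :=
  (principalSubspace n V.σ₁ V.σ₂ V.γin).orthogonalProjectionOnto ∘L blownΦ V n p₀

lemma coe_transformΦ {V : Data H E} (hV : V.IsCommutativeVessel) (n : ℕ)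
    (p₀ : MvPolynomial (Fin 2) ℝ) (h : H) :
    (transformΦ V n p₀ h : BlownSpace n E) = blownΦ V n p₀ h := by
  rw [transformΦ, ContinuousLinearMap.comp_apply]
  exact congrArg Subtype.val (Submodule.orthogonalProjectionOnto_mem_subspace_eq_self
    (⟨_, blownΦ_mem hV n p₀ h⟩ : principalSubspace n V.σ₁ V.σ₂ V.γin))

lemma inner_bezout_transformΦ {V : Data H E} (hV : V.IsCommutativeVessel) {n : ℕ}
    {p q : MvPolynomial (Fin 2) ℝ} (p₀ : MvPolynomial (Fin 2) ℝ)
    (β : BezoutTriple n (homogenize n p) (homogenize n q)) (h k : H) :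
    inner ℂ (transformΦ V n p₀ h) (bezout V.σ₁ V.σ₂ V.γin β (transformΦ V n p₀ k)) =
      (1 / Complex.I) *
        (inner ℂ (Ring.inverse (evalOp p₀ V.A₁.adjoint V.A₂.adjoint) h)
          (evalOp p V.A₁ V.A₂ (evalOp q V.A₁.adjoint V.A₂.adjoint
            (Ring.inverse (evalOp p₀ V.A₁.adjoint V.A₂.adjoint) k))) -
        inner ℂ (Ring.inverse (evalOp p₀ V.A₁.adjoint V.A₂.adjoint) h)
          (evalOp q V.A₁ V.A₂ (evalOp p V.A₁.adjoint V.A₂.adjoint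
            (Ring.inverse (evalOp p₀ V.A₁.adjoint V.A₂.adjoint) k)))) := by
  set h' := Ring.inverse (evalOp p₀ V.A₁.adjoint V.A₂.adjoint) h with hh'
  set k' := Ring.inverse (evalOp p₀ V.A₁.adjoint V.A₂.adjoint) k with hk'
  have hA : Commute V.A₁ V.A₂ := hV.commute
  -- By the colligation conditions, `σ_k` between values of `Φ` is `(1/i)(A_k - A_k*)`: here `x_k`
  -- is `A_k` and `y_k` is `A_k*`.
  let m : ℕ → ℕ → H →L[ℂ] ℂ := fun a b =>
    (1 / Complex.I) • (innerSL ℂ h' ∘L (V.A₁ ^ a * V.A₂ ^ b))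
  have hm : ∀ a b x, m a b x = (1 / Complex.I) * inner ℂ h' ((V.A₁ ^ a * V.A₂ ^ b) x) :=
    fun a b x => rfl
  have heval : ∀ (r : MvPolynomial (Fin 2) ℝ) x,
      evalFunctional m r x = (1 / Complex.I) * inner ℂ h' (evalOp r V.A₁ V.A₂ x) := by
    intro r x
    simp only [evalFunctional, evalOp, sum_apply, smul_apply, hm, inner_sum, inner_smul_right,
      Finset.mul_sum, smul_eq_mul]
    refine Finset.sum_congr rfl fun e _ => ?_
    ring
  have hadj : ∀ (a b : ℕ) x, inner ℂ ((V.A₁.adjoint ^ a * V.A₂.adjoint ^ b) h') x =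
      inner ℂ h' ((V.A₁ ^ a * V.A₂ ^ b) x) := by
    intro a b x
    rw [← ContinuousLinearMap.adjoint_inner_left (V.A₁ ^ a * V.A₂ ^ b)]
    simp only [← ContinuousLinearMap.star_eq_adjoint, star_mul, star_pow]
    rw [(hA.star_star.pow_pow a b).eq]
  rw [inner_bezout_left, coe_transformΦ hV, coe_transformΦ hV, mul_sub, ← heval, ← heval]
  refine inner_bezoutBlown hV.commute_adjoint hV.input_apply β (fun i x => ?_) (fun i x => ?_)
    (fun j => blownΦ_apply V n p₀ k j)
  · rw [blownΦ_apply, hV.inner_σ₁, hadj, hadj, hm, hm, ← mul_sub, ← mul_apply_eq_comp _ V.A₁,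
      mul_assoc, ← (hA.pow_right _).eq, ← mul_assoc, ← pow_succ]
  · rw [blownΦ_apply, hV.inner_σ₂, hadj, hadj, hm, hm, ← mul_sub, ← mul_apply_eq_comp _ V.A₂,
      mul_assoc, ← pow_succ]

/-- The range of `Φ'` need not be all of `V_n`, so `v` must be arbitrary. One `m` serves all pairs
`p, q`, which allows cancellation between different Bezout matrices. -/
lemma exists_inner_bezout_eq {V : Data H E} (hV : V.IsCommutativeVessel) {n : ℕ}
    (p₀ : MvPolynomial (Fin 2) ℝ) (v : V.E' n) :
    ∃ m : ℕ → ℕ → H →L[ℂ] ℂ, ∀ (p q : MvPolynomial (Fin 2) ℝ)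
      (β : BezoutTriple n (homogenize n p) (homogenize n q)) (k : H),
      inner ℂ v (bezout V.σ₁ V.σ₂ V.γin β (transformΦ V n p₀ k)) =
        evalFunctional m p (evalOp q V.A₁.adjoint V.A₂.adjoint
          (Ring.inverse (evalOp p₀ V.A₁.adjoint V.A₂.adjoint) k)) -
        evalFunctional m q (evalOp p V.A₁.adjoint V.A₂.adjoint
          (Ring.inverse (evalOp p₀ V.A₁.adjoint V.A₂.adjoint) k)) := by
  let l (σ : E →L[ℂ] E) (a b : ℕ) : H →L[ℂ] ℂ :=
    -- The value outside the index set is never used: compatibility is only required for `a + b + 1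
    -- < n`.
    if h : a + b < n then innerSL ℂ ((v : BlownSpace n E) (mkIdx a b h)) ∘L σ ∘L V.Φ else 0
  have hl : ∀ σ a b (h : a + b < n) x,
      l σ a b x = inner ℂ ((v : BlownSpace n E) (mkIdx a b h)) (σ (V.Φ x)) := by
    intro σ a b h x
    simp only [l, dif_pos h]
    rfl
  have h₁ := ContinuousLinearMap.isSelfAdjoint_iff_isSymmetric.1 hV.σ₁_selfAdjoint
  have h₂ := ContinuousLinearMap.isSelfAdjoint_iff_isSymmetric.1 hV.σ₂_selfAdjoint
  have hγ := ContinuousLinearMap.isSelfAdjoint_iff_isSymmetric.1 hV.γin_selfAdjoint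
  obtain ⟨m, hm⟩ := exists_divided_difference hV.commute_adjoint n (l V.σ₁) (l V.σ₂) (by
    intro a b hab x
    rw [hl _ _ _ (by omega), hl _ _ _ (by omega), hl _ _ _ (by omega), hl _ _ _ (by omega)]
    -- Pairing the equation of `V_n` at `(a, b)` with `Φ x` and moving the selfadjoint coefficients
    -- across gives compatibility, once the input condition eliminates `γⁱⁿ`.
    have hv := congrArg (fun e => inner ℂ e (V.Φ x)) (v.2 a b hab)
    simp only [inner_add_left, inner_sub_left, inner_zero_left] at hv
    have e₁ := h₁ ((v : BlownSpace n E) (mkIdx a (b + 1) (by omega))) (V.Φ x)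
    have e₂ := h₂ ((v : BlownSpace n E) (mkIdx (a + 1) b (by omega))) (V.Φ x)
    have eγ := hγ ((v : BlownSpace n E) (mkIdx a b (by omega))) (V.Φ x)
    simp only [ContinuousLinearMap.coe_coe] at e₁ e₂ eγ
    rw [e₁, e₂, eγ, hV.input_apply, inner_sub_right] at hv
    linear_combination hv)
  refine ⟨m, fun p q β k => ?_⟩
  rw [inner_bezout_left, coe_transformΦ hV]
  refine inner_bezoutBlown hV.commute_adjoint hV.input_apply β (fun i x => ?_) (fun i x => ?_)
    (fun j => blownΦ_apply V n p₀ k j)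
  · rw [← (hm i.1.1 i.1.2 i.2 x).1, hl _ _ _ i.2]
  · rw [← (hm i.1.1 i.1.2 i.2 x).2, hl _ _ _ i.2]

lemma transform_colligation {V : Data H E} (hV : V.IsCommutativeVessel) {n : ℕ}
    {p p₀ : MvPolynomial (Fin 2) ℝ} (hp₀ : IsUnit (evalOp p₀ V.A₁ V.A₂))
    (β : BezoutTriple n (homogenize n p) (homogenize n p₀)) :
    (transformΦ V n p₀).adjoint ∘L bezout V.σ₁ V.σ₂ V.γin β ∘L transformΦ V n p₀ =
      (1 / Complex.I) • (evalOp p V.A₁ V.A₂ * Ring.inverse (evalOp p₀ V.A₁ V.A₂) -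
        (evalOp p V.A₁ V.A₂ * Ring.inverse (evalOp p₀ V.A₁ V.A₂)).adjoint) := by
  have hA : Commute V.A₁ V.A₂ := hV.commute
  have hu := isUnit_evalOp_adjoint hV hp₀
  ext k
  refine ext_inner_left ℂ fun h => ?_
  rw [ContinuousLinearMap.comp_apply, ContinuousLinearMap.adjoint_inner_right,
    ContinuousLinearMap.comp_apply, inner_bezout_transformΦ hV, smul_apply, sub_apply,
    inner_smul_right, inner_sub_right]
  have hinv : (Ring.inverse (evalOp p₀ V.A₁ V.A₂)).adjoint =
      Ring.inverse (evalOp p₀ V.A₁.adjoint V.A₂.adjoint) := by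
    rw [← adjoint_evalOp hA]
    exact (Ring.inverse_star _).symm
  -- Moving `p₀(A*)⁻¹` off `h` leaves `p₀(A)⁻¹` on the right, where it cancels `p₀(A)` in the second
  -- term; `p₀(A*)` cancels in the first.
  rw [← hinv, ContinuousLinearMap.adjoint_inner_left, ContinuousLinearMap.adjoint_inner_left,
    hinv, adjoint_div hV]
  simp only [← mul_apply_eq_comp]
  rw [Ring.mul_inverse_cancel _ hu,
    ← mul_assoc (Ring.inverse (evalOp p₀ V.A₁ V.A₂)) (evalOp p₀ V.A₁ V.A₂),
    Ring.inverse_mul_cancel _ hp₀,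
    mul_one, one_mul,
    (commute_ringInverse_right hp₀ (commute_evalOp_evalOp hA p p₀)).eq,
    (commute_ringInverse_right hu (commute_evalOp_evalOp hV.commute_adjoint p p₀)).eq]

lemma transform_input {V : Data H E} (hV : V.IsCommutativeVessel) {n : ℕ}
    {p₀ p₁ p₂ : MvPolynomial (Fin 2) ℝ} (hp₀ : IsUnit (evalOp p₀ V.A₁ V.A₂))
    (β₁ : BezoutTriple n (homogenize n p₁) (homogenize n p₀))
    (β₂ : BezoutTriple n (homogenize n p₂) (homogenize n p₀))
    (β : BezoutTriple n (homogenize n p₁) (homogenize n p₂)) :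
    bezout V.σ₁ V.σ₂ V.γin β ∘L transformΦ V n p₀ =
      bezout V.σ₁ V.σ₂ V.γin β₁ ∘L transformΦ V n p₀ ∘L
        (evalOp p₂ V.A₁ V.A₂ * Ring.inverse (evalOp p₀ V.A₁ V.A₂)).adjoint -
      bezout V.σ₁ V.σ₂ V.γin β₂ ∘L transformΦ V n p₀ ∘L
        (evalOp p₁ V.A₁ V.A₂ * Ring.inverse (evalOp p₀ V.A₁ V.A₂)).adjoint := by
  have hc := hV.commute_adjoint
  have hu := isUnit_evalOp_adjoint hV hp₀
  ext1 k
  refine ext_inner_left ℂ fun v => ?_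
  obtain ⟨m, hm⟩ := exists_inner_bezout_eq hV p₀ v
  rw [adjoint_div hV, adjoint_div hV]
  simp only [ContinuousLinearMap.comp_apply, sub_apply, inner_sub_right]
  rw [hm, hm, hm]
  simp only [← mul_apply_eq_comp]
  set P₀ := evalOp p₀ V.A₁.adjoint V.A₂.adjoint
  set P₁ := evalOp p₁ V.A₁.adjoint V.A₂.adjoint
  set P₂ := evalOp p₂ V.A₁.adjoint V.A₂.adjoint
  have h₁₂ : P₁ * P₂ = P₂ * P₁ := (commute_evalOp_evalOp hc p₁ p₂).eq
  have h₁ : P₁ * Ring.inverse P₀ = Ring.inverse P₀ * P₁ :=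
    (commute_ringInverse_right hu (commute_evalOp_evalOp hc p₁ p₀)).eq
  have h₂ : P₂ * Ring.inverse P₀ = Ring.inverse P₀ * P₂ :=
    (commute_ringInverse_right hu (commute_evalOp_evalOp hc p₂ p₀)).eq
  have hc₁ : P₀ * (Ring.inverse P₀ * (Ring.inverse P₀ * P₁)) = P₁ * Ring.inverse P₀ := by
    rw [← mul_assoc, Ring.mul_inverse_cancel _ hu, one_mul, h₁]
  have hc₂ : P₀ * (Ring.inverse P₀ * (Ring.inverse P₀ * P₂)) = P₂ * Ring.inverse P₀ := by
    rw [← mul_assoc, Ring.mul_inverse_cancel _ hu, one_mul, h₂]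
  -- Makes the two contributions of `evalFunctional m p₀` cancel; what remains is the expression for
  -- the pair `(p₁, p₂)`.
  have hx : P₁ * (Ring.inverse P₀ * (Ring.inverse P₀ * P₂)) =
      P₂ * (Ring.inverse P₀ * (Ring.inverse P₀ * P₁)) := by
    rw [← h₁, ← mul_assoc P₂, h₂, mul_assoc, ← mul_assoc P₂, ← h₁₂, ← h₂, ← mul_assoc P₁, h₁,
      mul_assoc, mul_assoc]
  rw [hc₁, hc₂, hx]
  ring

end Transform

end Vessel

end

theorem theorem3p1 {H E : Type*}
    [NormedAddCommGroup H] [InnerProductSpace ℂ H] [CompleteSpace H]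
    [NormedAddCommGroup E] [InnerProductSpace ℂ E] [FiniteDimensional ℂ E] [CompleteSpace E]
    (V : Vessel.Data H E) (hV : V.IsCommutativeVessel)
    (p₀ p₁ p₂ : MvPolynomial (Fin 2) ℝ)
    (hp₀ : IsUnit (Vessel.evalOp p₀ V.A₁ V.A₂))
    (n : ℕ) (hn : n = Vessel.maxDegree p₀ p₁ p₂) :
    (Nonempty (Vessel.BezoutTriple n (Vessel.homogenize n p₁) (Vessel.homogenize n p₀)) ∧
      Nonempty (Vessel.BezoutTriple n (Vessel.homogenize n p₂) (Vessel.homogenize n p₀)) ∧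
      Nonempty (Vessel.BezoutTriple n (Vessel.homogenize n p₁) (Vessel.homogenize n p₂))) ∧
    ∀ (β₁ : Vessel.BezoutTriple n (Vessel.homogenize n p₁) (Vessel.homogenize n p₀))
      (β₂ : Vessel.BezoutTriple n (Vessel.homogenize n p₂) (Vessel.homogenize n p₀))
      (β : Vessel.BezoutTriple n (Vessel.homogenize n p₁) (Vessel.homogenize n p₂)),
      (V.transform n p₀ p₁ p₂ β₁ β₂ β).IsCommutativeVessel := by
  have hd₀ : p₀.totalDegree ≤ n := hn ▸ le_max_left _ _
  have hd₁ : p₁.totalDegree ≤ n := hn ▸ (le_max_left _ _).trans (le_max_right _ _)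
  have hd₂ : p₂.totalDegree ≤ n := hn ▸ (le_max_right _ _).trans (le_max_right _ _)
  refine ⟨⟨Vessel.nonempty_bezoutTriple hd₁ hd₀, Vessel.nonempty_bezoutTriple hd₂ hd₀,
    Vessel.nonempty_bezoutTriple hd₁ hd₂⟩, fun β₁ β₂ β => ?_⟩
  have hA : Commute V.A₁ V.A₂ := hV.commute
  have hR : ∀ p, Commute (Vessel.evalOp p V.A₁ V.A₂)
      (Ring.inverse (Vessel.evalOp p₀ V.A₁ V.A₂)) := fun p =>
    Vessel.commute_ringInverse_right hp₀ (Vessel.commute_evalOp_evalOp hA p p₀)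
  have s₁ := Vessel.isSelfAdjoint_bezout hV.σ₁_selfAdjoint hV.σ₂_selfAdjoint
    hV.γin_selfAdjoint β₁
  have s₂ := Vessel.isSelfAdjoint_bezout hV.σ₁_selfAdjoint hV.σ₂_selfAdjoint
    hV.γin_selfAdjoint β₂
  have s := Vessel.isSelfAdjoint_bezout hV.σ₁_selfAdjoint hV.σ₂_selfAdjoint
    hV.γin_selfAdjoint β
  have c₁ := Vessel.transform_colligation hV hp₀ β₁
  have c₂ := Vessel.transform_colligation hV hp₀ β₂
  have hin := Vessel.transform_input hV hp₀ β₁ β₂ β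
  exact Vessel.isCommutativeVessel_of_input
    (((Vessel.commute_evalOp_evalOp hA p₁ p₂).mul_right (hR p₁)).mul_left
      ((hR p₂).symm.mul_right (Commute.refl _))).eq s₁ s₂ s c₁ c₂ hin rfl
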